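/- For every $n\ge 1$ let $X_{n,1},\dots,X_{n,n}$ be independent random variables, each uniformly distributed on $\{1,\dots,m_n\}$, that is, $\mathbb P(X_{n,k}=i)=p_n(i)=1/m_n$ for $1\le i\le m_n$, where the positive integers $m_n$ satisfy $m_n\to\infty$ as $n\to\infty$. (Nothing is assumed about the joint law for different $n$; the variables may live on different probability spaces.) Let $$\hat p_n(i)=\frac1n\sum_{k=1}^n \mathbf 1(X_{n,k}=i),\qquad \chi_n^2=n\sum_{i=1}^{m_n}\frac{(\hat p_n(i)-p_n(i))^2}{p_n(i)}$$ be the empirical frequencies and Pearson's chi-square statistic. Suppose that $n/\sqrt{m_n}\to\lambda$ as $n\to\infty$, with $\lambda\in[0,\infty]$. Then, as $n\to\infty$, $$\frac{\chi_n^2-m_n}{\sqrt{2m_n}}$$ converges in distribution - to the constant $0$, if $\lambda=0$; - to $\frac{\sqrt2}{\lambda}Z-\frac{\lambda}{\sqrt2}$, where $Z$ is Poisson distributed with mean $\lambda^2/2$, if $0<\lambda<\infty$; - to a standard normal random variable, if $\lambda=\infty$. -/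

import Mathlib

open MeasureTheory ProbabilityTheory Filter Topology

/-- The empirical frequency of category `i` in the sample `x` of size `n`:
`n⁻¹ ∑ₖ 1(xₖ = i)`. -/
noncomputable def empiricalFreq {n m : ℕ} (x : Fin n → Fin m) (i : Fin m) : ℝ :=
  (n : ℝ)⁻¹ * ∑ k : Fin n, if x k = i then (1 : ℝ) else 0

/-- Pearson's chi-square statistic of the sample `x` of size `n` for the hypothesised
probabilities `p` of the `m` categories: `n ∑ᵢ (p̂(i) - p(i))² / p(i)`. -/
noncomputable def pearsonChiSq {n m : ℕ} (p : Fin m → ℝ) (x : Fin n → Fin m) : ℝ :=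
  (n : ℝ) * ∑ i : Fin m, (empiricalFreq x i - p i) ^ 2 / p i

/-- The standardised statistic `(χ² - m) / √(2m)`. -/
noncomputable def standardizedChiSq {n m : ℕ} (p : Fin m → ℝ) (x : Fin n → Fin m) : ℝ :=
  (pearsonChiSq p x - (m : ℝ)) / √(2 * (m : ℝ))

/-! Expanding the squares turns the statistic into an affine function of the number C of coinciding
pairs: it equals √(2m)/n · C - n/√(2m) (`standardizedChiSq_eq`). By independence the sample is
uniform on a finite set, so every characteristic function is a finite average `𝔼`. Draw the points
one at a time. A new point increases C by the current count of its cell (`coincidences_cons`), so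
the characteristic functions after k points satisfy f (k+1) ≈ ρ k * f k. When ‖ρ k‖ ≤ 1 the errors
merely add up (`norm_sub_prod_le`). If n/√m stays bounded, the increment is nearly Bernoulli with
parameter k/m, and the product of the ρ k is a Poisson characteristic function with error 7n³/m².
This covers both finite limits. If n/√m → ∞, the centred count is a martingale. A second-order
Taylor expansion of its increments gives Gaussian factors; the errors are controlled by fourth
moments of binomial counts and by the variance of C, which bounds the fluctuation of the conditional
variance. -/

open scoped BigOperators

set_option linter.unusedSectionVars false

/-! ### Cell counts and coinciding pairs. -/

section OccupancyCounts

variable {ι : Type*} [DecidableEq ι] {k : ℕ}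

/-- The number of sample points falling into category `i`. -/
def cellCount (x : Fin k → ι) (i : ι) : ℕ := ∑ j, if x j = i then 1 else 0

lemma cellCount_cons (i : ι) (y : Fin k → ι) (j : ι) :
    cellCount (Fin.cons i y : Fin (k + 1) → ι) j = (if i = j then 1 else 0) + cellCount y j := by
  unfold cellCount
  rw [Fin.sum_univ_succ]
  simp only [Fin.cons_zero, Fin.cons_succ]

variable [Fintype ι]

lemma sum_cellCount (x : Fin k → ι) : ∑ i, cellCount x i = k := by
  unfold cellCount
  rw [Finset.sum_comm]
  simp

/-- The number of pairs of sample points falling into the same category. -/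
noncomputable def coincidences (x : Fin k → ι) : ℝ :=
  ∑ i, (cellCount x i : ℝ) * (cellCount x i - 1) / 2

lemma coincidences_nonneg (x : Fin k → ι) : 0 ≤ coincidences x := by
  refine Finset.sum_nonneg fun i _ => ?_
  rcases Nat.eq_zero_or_pos (cellCount x i) with h | h
  · simp [h]
  · have : (1 : ℝ) ≤ cellCount x i := by exact_mod_cast h
    have : (0 : ℝ) ≤ cellCount x i - 1 := by linarith
    positivity

lemma coincidences_zero (x : Fin 0 → ι) : coincidences x = 0 := by
  simp [coincidences, cellCount]

/-- The new point forms one new pair with each earlier point of its cell. Both limit regimes rest on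
this recursion. -/
lemma coincidences_cons (i : ι) (y : Fin k → ι) :
    coincidences (Fin.cons i y : Fin (k + 1) → ι) = coincidences y + cellCount y i := by
  have h : ∀ j, (cellCount (Fin.cons i y : Fin (k + 1) → ι) j : ℝ) *
      (cellCount (Fin.cons i y : Fin (k + 1) → ι) j - 1) / 2 =
      (cellCount y j : ℝ) * (cellCount y j - 1) / 2 + if i = j then (cellCount y j : ℝ) else 0 := by
    intro j
    rw [cellCount_cons]
    split_ifs <;> push_cast <;> ring
  simp only [coincidences, h, Finset.sum_add_distrib, Finset.sum_ite_eq, Finset.mem_univ, if_true]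

lemma sum_cellCount_sq (x : Fin k → ι) :
    ∑ i, (cellCount x i : ℝ) ^ 2 = 2 * coincidences x + k := by
  have h : (∑ i, (cellCount x i : ℝ)) = k := by exact_mod_cast sum_cellCount x
  rw [← h, coincidences, Finset.mul_sum, ← Finset.sum_add_distrib]
  exact Finset.sum_congr rfl fun i _ => by ring

end OccupancyCounts

/-! ### Moments under uniform sampling. -/

section UniformAverages

variable {ι : Type*} [Fintype ι] [DecidableEq ι]

lemma expect_fin_cons {M : Type*} [AddCommMonoid M] [Module ℚ≥0 M] {k : ℕ}
    (f : (Fin (k + 1) → ι) → M) :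
    (𝔼 x, f x) = 𝔼 y : Fin k → ι, 𝔼 i, f (Fin.cons i y) := by
  rw [Finset.expect_comm]
  have := Finset.expect_product (Finset.univ : Finset ι) (Finset.univ : Finset (Fin k → ι))
    (fun z => f (Fin.cons z.1 z.2))
  rw [← this, Finset.univ_product_univ]
  exact (Fintype.expect_equiv (Fin.consEquiv fun _ => ι) _ _ fun z => rfl).symm

variable [Nonempty ι]

lemma expect_ite_eq_const (i : ι) (a b : ℝ) :
    (𝔼 j, if j = i then a else b) =
      (Fintype.card ι : ℝ)⁻¹ * a + (1 - (Fintype.card ι : ℝ)⁻¹) * b := by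
  have h : ∀ j, (if j = i then a else b) = b + if j = i then (a - b) else 0 := by
    intro j; split_ifs <;> ring
  simp only [h, Finset.expect_add_distrib, Fintype.expect_const]
  rw [Fintype.expect_eq_sum_div_card (fun j => if j = i then a - b else 0)]
  simp only [Finset.sum_ite_eq', Finset.mem_univ, if_true]
  ring

lemma expect_cellCount_cons_apply {k : ℕ} (F : ℝ → ℝ) (i : ι) :
    (𝔼 x : Fin (k + 1) → ι, F (cellCount x i)) = 𝔼 y : Fin k → ι,
      ((Fintype.card ι : ℝ)⁻¹ * F (cellCount y i + 1) +
        (1 - (Fintype.card ι : ℝ)⁻¹) * F (cellCount y i)) := by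
  rw [expect_fin_cons]
  refine Finset.expect_congr rfl fun y _ => ?_
  rw [← expect_ite_eq_const i]
  refine Finset.expect_congr rfl fun j _ => ?_
  rw [cellCount_cons]
  split_ifs <;> simp [add_comm]

lemma card_inv_nonneg : (0 : ℝ) ≤ (Fintype.card ι : ℝ)⁻¹ := by positivity

lemma card_inv_le_one : (Fintype.card ι : ℝ)⁻¹ ≤ 1 :=
  inv_le_one_of_one_le₀ (by exact_mod_cast Fintype.card_pos)

lemma expect_cellCount_sub (k : ℕ) (i : ι) :
    (𝔼 x : Fin k → ι, ((cellCount x i : ℝ) - k * (Fintype.card ι : ℝ)⁻¹)) = 0 := by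
  induction k with
  | zero => simp [cellCount]
  | succ k ih =>
    rw [expect_cellCount_cons_apply (fun c => c - ((k + 1 : ℕ) : ℝ) * (Fintype.card ι : ℝ)⁻¹) i]
    rw [← ih]
    refine Finset.expect_congr rfl fun y _ => ?_
    push_cast; ring

/-- The variance of a binomial count. -/
lemma expect_cellCount_sub_sq (k : ℕ) (i : ι) :
    (𝔼 x : Fin k → ι, ((cellCount x i : ℝ) - k * (Fintype.card ι : ℝ)⁻¹) ^ 2) =
      k * ((Fintype.card ι : ℝ)⁻¹ * (1 - (Fintype.card ι : ℝ)⁻¹)) := by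
  induction k with
  | zero => simp [cellCount]
  | succ k ih =>
    rw [expect_cellCount_cons_apply
      (fun c => (c - ((k + 1 : ℕ) : ℝ) * (Fintype.card ι : ℝ)⁻¹) ^ 2) i]
    set p := (Fintype.card ι : ℝ)⁻¹
    have h : ∀ y : Fin k → ι,
        p * ((cellCount y i : ℝ) + 1 - ((k + 1 : ℕ) : ℝ) * p) ^ 2 +
          (1 - p) * ((cellCount y i : ℝ) - ((k + 1 : ℕ) : ℝ) * p) ^ 2 =
        ((cellCount y i : ℝ) - k * p) ^ 2 + p * (1 - p) := by
      intro y; push_cast; ring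
    simp only [h, Finset.expect_add_distrib, Fintype.expect_const, ih]
    push_cast; ring

/-- A bound for the fourth central moment of a binomial count. -/
lemma expect_cellCount_sub_pow_four_le (k : ℕ) (i : ι) :
    (𝔼 x : Fin k → ι, ((cellCount x i : ℝ) - k * (Fintype.card ι : ℝ)⁻¹) ^ 4) ≤
      3 * (k * (Fintype.card ι : ℝ)⁻¹) ^ 2 + k * (Fintype.card ι : ℝ)⁻¹ := by
  induction k with
  | zero => simp [cellCount]
  | succ k ih =>
    have e1 := expect_cellCount_sub k i
    have e2 := expect_cellCount_sub_sq k i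
    have hp0 := card_inv_nonneg (ι := ι)
    have hp1 := card_inv_le_one (ι := ι)
    rw [expect_cellCount_cons_apply
      (fun c => (c - ((k + 1 : ℕ) : ℝ) * (Fintype.card ι : ℝ)⁻¹) ^ 4) i]
    set p := (Fintype.card ι : ℝ)⁻¹
    -- Expansion of (D + B)⁴ averaged over an independent centred Bernoulli B. The D³ term drops
    -- since B has mean zero, and the D term will drop since D does.
    have h : ∀ y : Fin k → ι,
        p * ((cellCount y i : ℝ) + 1 - ((k + 1 : ℕ) : ℝ) * p) ^ 4 +
          (1 - p) * ((cellCount y i : ℝ) - ((k + 1 : ℕ) : ℝ) * p) ^ 4 =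
        ((cellCount y i : ℝ) - k * p) ^ 4 +
          (6 * (p * (1 - p)) * ((cellCount y i : ℝ) - k * p) ^ 2 +
          (4 * (p * (1 - p) * (1 - 2 * p)) * ((cellCount y i : ℝ) - k * p) +
          p * (1 - p) * (1 - 3 * p + 3 * p ^ 2))) := by
      intro y; push_cast; ring
    simp only [h, Finset.expect_add_distrib, Fintype.expect_const, ← Finset.mul_expect, e1, e2]
    have hk : (0 : ℝ) ≤ k := by positivity
    have hq : p * (1 - p) ≤ p := by nlinarith
    have hq0 : 0 ≤ p * (1 - p) := mul_nonneg hp0 (by linarith)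
    have h6 : (p * (1 - p)) * (k * (p * (1 - p))) ≤ p * (k * p) := by gcongr
    have h7 : p * (1 - p) * (1 - 3 * p + 3 * p ^ 2) ≤ p * 1 := by
      have : 1 - 3 * p + 3 * p ^ 2 ≤ 1 := by nlinarith
      have h0 : 0 ≤ 1 - 3 * p + 3 * p ^ 2 := by nlinarith [sq_nonneg (2 * p - 1)]
      gcongr
    push_cast
    nlinarith [sq_nonneg p]

lemma expect_cellCount {k : ℕ} (y : Fin k → ι) :
    (𝔼 i, (cellCount y i : ℝ)) = k * (Fintype.card ι : ℝ)⁻¹ := by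
  rw [Fintype.expect_eq_sum_div_card, ← Nat.cast_sum, sum_cellCount, div_eq_mul_inv]

lemma expect_cellCount_sq {k : ℕ} (y : Fin k → ι) :
    (𝔼 i, (cellCount y i : ℝ) ^ 2) = (2 * coincidences y + k) * (Fintype.card ι : ℝ)⁻¹ := by
  rw [Fintype.expect_eq_sum_div_card, sum_cellCount_sq, div_eq_mul_inv]

variable (ι) in
/-- The expected number of coincidences in a uniform sample of size `k`. -/
noncomputable def meanCoincidences (k : ℕ) : ℝ :=
  k * (k - 1) / 2 * (Fintype.card ι : ℝ)⁻¹

lemma expect_sub_mean {k : ℕ} (y : Fin k → ι) :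
    (𝔼 i, ((cellCount y i : ℝ) - k * (Fintype.card ι : ℝ)⁻¹)) = 0 := by
  rw [Finset.expect_sub_distrib, expect_cellCount, Fintype.expect_const, sub_self]

/-- This is the conditional variance of the next martingale increment: a deterministic part plus a
multiple of the current fluctuation of C. The latter must be shown negligible in the Gaussian
regime. -/
lemma expect_sub_mean_sq {k : ℕ} (y : Fin k → ι) :
    (𝔼 i, ((cellCount y i : ℝ) - k * (Fintype.card ι : ℝ)⁻¹) ^ 2) =
      k * ((Fintype.card ι : ℝ)⁻¹ * (1 - (Fintype.card ι : ℝ)⁻¹)) +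
        2 * (Fintype.card ι : ℝ)⁻¹ * (coincidences y - meanCoincidences ι k) := by
  have e1 := expect_cellCount y
  have e2 := expect_cellCount_sq y
  unfold meanCoincidences
  set p := (Fintype.card ι : ℝ)⁻¹
  have h : ∀ i, ((cellCount y i : ℝ) - k * p) ^ 2 =
      (cellCount y i : ℝ) ^ 2 - (2 * (k * p)) * cellCount y i + (k * p) ^ 2 := by
    intro i; ring
  simp only [h, Finset.expect_add_distrib, Finset.expect_sub_distrib, Fintype.expect_const,
    ← Finset.mul_expect, e1, e2]
  ring

lemma meanCoincidences_succ (k : ℕ) :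
    meanCoincidences ι (k + 1) = meanCoincidences ι k + k * (Fintype.card ι : ℝ)⁻¹ := by
  unfold meanCoincidences; push_cast; ring

lemma expect_coincidences (k : ℕ) :
    (𝔼 x : Fin k → ι, coincidences x) = meanCoincidences ι k := by
  induction k with
  | zero => simp [coincidences_zero, meanCoincidences]
  | succ k ih =>
    rw [expect_fin_cons]
    simp only [coincidences_cons, Finset.expect_add_distrib, Fintype.expect_const,
      expect_cellCount, ih, meanCoincidences_succ]

/-- The variance of the number of coincidences. -/
lemma expect_coincidences_sub_sq (k : ℕ) :
    (𝔼 x : Fin k → ι, (coincidences x - meanCoincidences ι k) ^ 2) =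
      meanCoincidences ι k * (1 - (Fintype.card ι : ℝ)⁻¹) := by
  induction k with
  | zero => simp [coincidences_zero, meanCoincidences]
  | succ k ih =>
    rw [expect_fin_cons]
    have h : ∀ (y : Fin k → ι) (i : ι),
        (coincidences (Fin.cons i y : Fin (k + 1) → ι) - meanCoincidences ι (k + 1)) ^ 2 =
        (coincidences y - meanCoincidences ι k) ^ 2 +
        (2 * (coincidences y - meanCoincidences ι k) *
          ((cellCount y i : ℝ) - k * (Fintype.card ι : ℝ)⁻¹) +
        ((cellCount y i : ℝ) - k * (Fintype.card ι : ℝ)⁻¹) ^ 2) := by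
      intro y i
      rw [coincidences_cons, meanCoincidences_succ]; ring
    simp only [h]
    -- The cross term vanishes by the martingale property; the random part of the conditional
    -- variance then averages to zero.
    simp only [Finset.expect_add_distrib, Fintype.expect_const, ← Finset.mul_expect,
      expect_sub_mean, expect_sub_mean_sq, ih]
    simp only [Finset.expect_sub_distrib, Fintype.expect_const, expect_coincidences, mul_zero,
      Finset.expect_const_zero]
    rw [meanCoincidences_succ]
    ring

end UniformAverages

/-! ### Elementary estimates for exponentials and recursive products. -/

section ExponentialBounds

lemma norm_cexp_ofReal_mul_I_sub_taylor_le (x : ℝ) :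
    ‖Complex.exp (x * Complex.I) - (1 + x * Complex.I - (x : ℂ) ^ 2 / 2)‖ ≤ 4 * |x| ^ 3 := by
  rcases le_or_gt |x| 1 with h | h
  · have hx : ‖(x : ℂ) * Complex.I‖ = |x| := by simp
    have := Complex.exp_bound (x := (x : ℂ) * Complex.I) (by rw [hx]; exact h) (n := 3) (by norm_num)
    rw [hx] at this
    have e : ∑ m ∈ Finset.range 3, ((x : ℂ) * Complex.I) ^ m / (m.factorial : ℂ) =
        1 + x * Complex.I - (x : ℂ) ^ 2 / 2 := by
      simp [Finset.sum_range_succ, Nat.factorial, mul_pow]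
      ring
    rw [e] at this
    refine this.trans ?_
    norm_num [Nat.factorial]
    nlinarith [pow_nonneg (abs_nonneg x) 3]
  · have h1 : ‖Complex.exp (x * Complex.I)‖ = 1 := Complex.norm_exp_ofReal_mul_I x
    have h2 : ‖1 + x * Complex.I - (x : ℂ) ^ 2 / 2‖ ≤ 1 + |x| + |x| ^ 2 / 2 := by
      refine (norm_sub_le _ _).trans (add_le_add ((norm_add_le _ _).trans ?_) ?_) <;> simp
    refine (norm_sub_le _ _).trans ?_
    rw [h1]
    nlinarith [mul_pos (sub_pos.2 h) (sub_pos.2 h), pow_pos (zero_lt_one.trans h) 2,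
      mul_pos (sub_pos.2 h) (pow_pos (zero_lt_one.trans h) 2)]

/-- AM-GM replaces the absolute third moment by the computable second and fourth ones; ε is left
free to balance them. -/
lemma pow_three_abs_le (x : ℝ) {ε : ℝ} (hε : 0 < ε) :
    |x| ^ 3 ≤ (ε * x ^ 2 + x ^ 4 / ε) / 2 := by
  have h : 0 ≤ (ε * |x| - |x| ^ 2) ^ 2 / ε := by positivity
  have e : (ε * |x| - |x| ^ 2) ^ 2 / ε = ε * |x| ^ 2 - 2 * |x| ^ 3 + |x| ^ 4 / ε := by
    field_simp
    ring
  have e4 : |x| ^ 4 = x ^ 4 := by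
    rw [show (4 : ℕ) = 2 * 2 from rfl, pow_mul, sq_abs, ← pow_mul]
  rw [e, sq_abs, e4] at h
  linarith

lemma abs_le_sq_div_add (x : ℝ) {θ : ℝ} (hθ : 0 < θ) : |x| ≤ (x ^ 2 / θ + θ) / 2 := by
  have h : 0 ≤ (|x| - θ) ^ 2 / θ := by positivity
  have e : (|x| - θ) ^ 2 / θ = |x| ^ 2 / θ - 2 * |x| + θ := by
    field_simp
    ring
  rw [e, sq_abs] at h
  linarith

lemma abs_exp_neg_sub_one_add_le {x : ℝ} (hx : 0 ≤ x) : |Real.exp (-x) - (1 - x)| ≤ x ^ 2 := by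
  rcases le_or_gt x 1 with h | h
  · have := Real.abs_exp_sub_one_sub_id_le (x := -x) (by rw [abs_neg, abs_of_nonneg hx]; exact h)
    rw [neg_sq] at this
    convert this using 2
    ring
  · have h1 := Real.exp_pos (-x)
    have h2 : Real.exp (-x) ≤ 1 := Real.exp_le_one_iff.2 (by linarith)
    rw [abs_of_nonneg (by linarith)]
    nlinarith

/-- Linearisation of `z ^ c` at `z = 1` on the unit circle. -/
lemma norm_pow_sub_linear_le {z : ℂ} (hz : ‖z‖ = 1) (c : ℕ) :
    ‖z ^ c - (1 + c * (z - 1))‖ ≤ 3 * ((c : ℝ) * (c - 1)) := by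
  -- The error is zero for c = 0, 1. For c ≥ 2 the crude bound 2 + 2c suffices, and c = 2 fixes the
  -- constant 3.
  rcases c with _ | _ | c
  · simp
  · simp
  · have h1 : ‖z - 1‖ ≤ 2 := (norm_sub_le _ _).trans (by rw [hz]; norm_num)
    have h2 : ‖(1 : ℂ) + ((c + 1 + 1 : ℕ) : ℂ) * (z - 1)‖ ≤ 1 + (c + 1 + 1 : ℕ) * 2 := by
      refine (norm_add_le _ _).trans ?_
      rw [norm_one, norm_mul, Complex.norm_natCast]
      gcongr
    refine (norm_sub_le _ _).trans ?_
    rw [norm_pow, hz, one_pow]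
    refine (add_le_add_right h2 _).trans ?_
    push_cast
    nlinarith [(Nat.cast_nonneg c : (0 : ℝ) ≤ c)]

/-- Telescoping comparison of a recursively perturbed sequence with a product. -/
lemma norm_sub_prod_le (f ρ : ℕ → ℂ) (e : ℝ) (h0 : f 0 = 1) (n : ℕ)
    (hρ : ∀ k < n, ‖ρ k‖ ≤ 1) (hf : ∀ k < n, ‖f (k + 1) - ρ k * f k‖ ≤ e) :
    ‖f n - ∏ k ∈ Finset.range n, ρ k‖ ≤ n * e := by
  induction n with
  | zero => simp [h0]
  | succ n ih =>
    have ih' := ih (fun k hk => hρ k (by omega)) (fun k hk => hf k (by omega))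
    rw [Finset.prod_range_succ]
    have e1 : f (n + 1) - (∏ k ∈ Finset.range n, ρ k) * ρ n =
        (f (n + 1) - ρ n * f n) + ρ n * (f n - ∏ k ∈ Finset.range n, ρ k) := by ring
    rw [e1]
    refine (norm_add_le _ _).trans ?_
    rw [norm_mul]
    have h1 := hf n (by omega)
    have h2 : ‖ρ n‖ * ‖f n - ∏ k ∈ Finset.range n, ρ k‖ ≤ 1 * (n * e) :=
      mul_le_mul (hρ n (by omega)) ih' (norm_nonneg _) zero_le_one
    push_cast
    linarith

end ExponentialBounds

/-! ### Poisson and Gaussian approximation of the number of coincidences. -/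

section CharacteristicFunctionBounds

variable {ι : Type*} [Fintype ι] [DecidableEq ι] [Nonempty ι]

lemma sum_range_mul_card_inv (n : ℕ) :
    ∑ k ∈ Finset.range n, (k : ℝ) * (Fintype.card ι : ℝ)⁻¹ = meanCoincidences ι n := by
  induction n with
  | zero => simp [meanCoincidences]
  | succ n ih => rw [Finset.sum_range_succ, ih, meanCoincidences_succ]

lemma meanCoincidences_le {k n : ℕ} (h : k ≤ n) :
    meanCoincidences ι k ≤ (n : ℝ) ^ 2 / 2 * (Fintype.card ι : ℝ)⁻¹ := by
  unfold meanCoincidences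
  have h1 : (k : ℝ) ≤ n := by exact_mod_cast h
  have : (k : ℝ) * (k - 1) ≤ n ^ 2 := by nlinarith [(Nat.cast_nonneg k : (0 : ℝ) ≤ k)]
  gcongr

lemma meanCoincidences_nonneg (k : ℕ) : 0 ≤ meanCoincidences ι k := by
  rw [← expect_coincidences]
  exact Finset.expect_nonneg fun x _ => coincidences_nonneg x

/-- Given the first k points, the new factor is the average of z ^ c over the cell counts c.
Linearising it at z = 1 costs 6C/m, hence 3n²/m² on average, and linearising the exponential costs
4n²/m². -/
lemma norm_expect_cexp_sub_poisson_step_le (u : ℝ) {k n : ℕ} (hk : k ≤ n)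
    (hn : 2 * (n : ℝ) * (Fintype.card ι : ℝ)⁻¹ ≤ 1) :
    ‖(𝔼 x : Fin (k + 1) → ι, Complex.exp ((u * coincidences x : ℝ) * Complex.I)) -
      Complex.exp (k * (Fintype.card ι : ℂ)⁻¹ * (Complex.exp (u * Complex.I) - 1)) *
      𝔼 x : Fin k → ι, Complex.exp ((u * coincidences x : ℝ) * Complex.I)‖ ≤
    7 * (n : ℝ) ^ 2 * (Fintype.card ι : ℝ)⁻¹ ^ 2 := by
  set z := Complex.exp (u * Complex.I) with hz
  have hz1 : ‖z‖ = 1 := Complex.norm_exp_ofReal_mul_I u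
  set ρ := Complex.exp (k * (Fintype.card ι : ℂ)⁻¹ * (z - 1)) with hρ
  have hp0 := card_inv_nonneg (ι := ι)
  have hkn : (k : ℝ) ≤ n := by exact_mod_cast hk
  have hk0 : (0 : ℝ) ≤ k := by positivity
  have hρ1 : ‖ρ - (1 + k * (Fintype.card ι : ℂ)⁻¹ * (z - 1))‖ ≤
      4 * (n : ℝ) ^ 2 * (Fintype.card ι : ℝ)⁻¹ ^ 2 := by
    have hw : ‖(k : ℂ) * (Fintype.card ι : ℂ)⁻¹ * (z - 1)‖ ≤
        2 * (n : ℝ) * (Fintype.card ι : ℝ)⁻¹ := by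
      have h1 : ‖z - 1‖ ≤ 2 := (norm_sub_le _ _).trans (by rw [hz1]; norm_num)
      rw [norm_mul, norm_mul, norm_inv, Complex.norm_natCast, Complex.norm_natCast]
      calc (k : ℝ) * (Fintype.card ι : ℝ)⁻¹ * ‖z - 1‖ ≤ n * (Fintype.card ι : ℝ)⁻¹ * 2 := by
            gcongr
        _ = _ := by ring
    have := Complex.norm_exp_sub_one_sub_id_le (hw.trans hn)
    rw [sub_sub] at this
    refine this.trans ((pow_le_pow_left₀ (norm_nonneg _) hw 2).trans (le_of_eq (by ring)))
  have hin : ∀ y : Fin k → ι, ‖(𝔼 i, z ^ cellCount y i) - ρ‖ ≤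
      6 * (Fintype.card ι : ℝ)⁻¹ * coincidences y +
        4 * (n : ℝ) ^ 2 * (Fintype.card ι : ℝ)⁻¹ ^ 2 := by
    intro y
    have e1 : (𝔼 i, (1 + (cellCount y i : ℂ) * (z - 1))) =
        1 + k * (Fintype.card ι : ℂ)⁻¹ * (z - 1) := by
      rw [Finset.expect_add_distrib, Fintype.expect_const, ← Finset.expect_mul]
      rw [Fintype.expect_eq_sum_div_card, ← Nat.cast_sum, sum_cellCount, div_eq_mul_inv]
    have e2 : (𝔼 i, z ^ cellCount y i) - ρ =
        (𝔼 i, (z ^ cellCount y i - (1 + (cellCount y i : ℂ) * (z - 1)))) -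
          (ρ - (1 + k * (Fintype.card ι : ℂ)⁻¹ * (z - 1))) := by
      rw [Finset.expect_sub_distrib, e1]; ring
    rw [e2]
    refine (norm_sub_le _ _).trans (add_le_add ?_ hρ1)
    refine (RCLike.norm_expect_le (K := ℂ)).trans
      ((Finset.expect_le_expect fun i _ => norm_pow_sub_linear_le hz1 _).trans (le_of_eq ?_))
    rw [← Finset.mul_expect, Fintype.expect_eq_sum_div_card, coincidences, ← Finset.sum_div]
    ring
  have e3 : (𝔼 x : Fin (k + 1) → ι, Complex.exp ((u * coincidences x : ℝ) * Complex.I)) =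
      𝔼 y : Fin k → ι, Complex.exp ((u * coincidences y : ℝ) * Complex.I) *
        𝔼 i, z ^ cellCount y i := by
    rw [expect_fin_cons]
    refine Finset.expect_congr rfl fun y _ => ?_
    rw [Finset.mul_expect]
    refine Finset.expect_congr rfl fun i _ => ?_
    rw [coincidences_cons, hz, ← Complex.exp_nat_mul, ← Complex.exp_add]
    push_cast
    ring_nf
  rw [e3, Finset.mul_expect, ← Finset.expect_sub_distrib]
  refine (RCLike.norm_expect_le (K := ℂ)).trans ?_
  have h4 : ∀ y : Fin k → ι, ‖Complex.exp ((u * coincidences y : ℝ) * Complex.I) *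
        (𝔼 i, z ^ cellCount y i) - ρ * Complex.exp ((u * coincidences y : ℝ) * Complex.I)‖ ≤
      6 * (Fintype.card ι : ℝ)⁻¹ * coincidences y +
        4 * (n : ℝ) ^ 2 * (Fintype.card ι : ℝ)⁻¹ ^ 2 := by
    intro y
    rw [mul_comm ρ, ← mul_sub, norm_mul, Complex.norm_exp_ofReal_mul_I, one_mul]
    exact hin y
  refine (Finset.expect_le_expect fun y _ => h4 y).trans ?_
  rw [Finset.expect_add_distrib, Fintype.expect_const, ← Finset.mul_expect, expect_coincidences]
  have := meanCoincidences_le (ι := ι) hk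
  calc _ ≤ 6 * (Fintype.card ι : ℝ)⁻¹ * ((n : ℝ) ^ 2 / 2 * (Fintype.card ι : ℝ)⁻¹) +
        4 * (n : ℝ) ^ 2 * (Fintype.card ι : ℝ)⁻¹ ^ 2 := by gcongr
    _ = _ := by ring

/-- Poisson approximation of the number of coincidences in a sparse uniform sample. -/
theorem norm_expect_cexp_coincidences_sub_poisson_le (u : ℝ) (n : ℕ)
    (hn : 2 * (n : ℝ) * (Fintype.card ι : ℝ)⁻¹ ≤ 1) :
    ‖(𝔼 x : Fin n → ι, Complex.exp ((u * coincidences x : ℝ) * Complex.I)) -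
      Complex.exp (meanCoincidences ι n * (Complex.exp (u * Complex.I) - 1))‖ ≤
    n * (7 * (n : ℝ) ^ 2 * (Fintype.card ι : ℝ)⁻¹ ^ 2) := by
  have key := norm_sub_prod_le
    (fun k => 𝔼 x : Fin k → ι, Complex.exp ((u * coincidences x : ℝ) * Complex.I))
    (fun k => Complex.exp (k * (Fintype.card ι : ℂ)⁻¹ * (Complex.exp (u * Complex.I) - 1)))
    (7 * (n : ℝ) ^ 2 * (Fintype.card ι : ℝ)⁻¹ ^ 2) (by simp [coincidences_zero]) n
    (fun k _ => by
      rw [Complex.norm_exp, Real.exp_le_one_iff]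
      have e : ((k : ℂ) * (Fintype.card ι : ℂ)⁻¹ * (Complex.exp (u * Complex.I) - 1)).re =
          (k : ℝ) * (Fintype.card ι : ℝ)⁻¹ * (Real.cos u - 1) := by
        rw [show (k : ℂ) * (Fintype.card ι : ℂ)⁻¹ =
          (((k : ℝ) * (Fintype.card ι : ℝ)⁻¹ : ℝ) : ℂ) by push_cast; rfl, Complex.re_ofReal_mul,
          Complex.sub_re, Complex.exp_ofReal_mul_I_re, Complex.one_re]
      rw [e]
      exact mul_nonpos_of_nonneg_of_nonpos (by positivity) (by linarith [Real.cos_le_one u]))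
    (fun k hk => norm_expect_cexp_sub_poisson_step_le u hk.le hn)
  rw [← Complex.exp_sum, ← Finset.sum_mul] at key
  rw [← sum_range_mul_card_inv]
  rw [show ((∑ k ∈ Finset.range n, (k : ℝ) * (Fintype.card ι : ℝ)⁻¹ : ℝ) : ℂ) =
    ∑ k ∈ Finset.range n, (k : ℂ) * (Fintype.card ι : ℂ)⁻¹ by push_cast; rfl]
  exact key

/-- The variance of C is at most θ², and AM-GM stands in for Cauchy-Schwarz. -/
lemma expect_abs_coincidences_sub_le {k n : ℕ} (hk : k ≤ n) {θ : ℝ} (hθ : 0 < θ)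
    (h : (n : ℝ) ^ 2 / 2 * (Fintype.card ι : ℝ)⁻¹ ≤ θ ^ 2) :
    (𝔼 x : Fin k → ι, |coincidences x - meanCoincidences ι k|) ≤ θ := by
  refine (Finset.expect_le_expect fun x _ =>
    abs_le_sq_div_add (coincidences x - meanCoincidences ι k) hθ).trans ?_
  rw [← Finset.expect_div, Finset.expect_add_distrib, ← Finset.expect_div, Fintype.expect_const,
    expect_coincidences_sub_sq]
  have h1 := meanCoincidences_le (ι := ι) hk
  have h2 : meanCoincidences ι k * (1 - (Fintype.card ι : ℝ)⁻¹) ≤ θ ^ 2 := by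
    have := mul_nonneg (meanCoincidences_nonneg (ι := ι) k) (card_inv_nonneg (ι := ι))
    linarith
  have h3 : meanCoincidences ι k * (1 - (Fintype.card ι : ℝ)⁻¹) / θ ≤ θ := by
    rw [div_le_iff₀ hθ]; linarith
  linarith

/-- The three groups of terms in the bound are the cubic Taylor remainder, the fluctuation of the
conditional variance, and the linearisation of the Gaussian factor. -/
lemma norm_expect_cexp_sub_gaussian_step_le (u : ℝ) {k n : ℕ} (hk : k ≤ n) {θ ε : ℝ}
    (hθ : 0 < θ) (hε : 0 < ε) (h : (n : ℝ) ^ 2 / 2 * (Fintype.card ι : ℝ)⁻¹ ≤ θ ^ 2) :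
    ‖(𝔼 x : Fin (k + 1) → ι, Complex.exp
        ((u * (coincidences x - meanCoincidences ι (k + 1)) : ℝ) * Complex.I)) -
      (Real.exp (-(u ^ 2 / 2 *
        (k * ((Fintype.card ι : ℝ)⁻¹ * (1 - (Fintype.card ι : ℝ)⁻¹))))) : ℂ) *
      𝔼 x : Fin k → ι, Complex.exp
        ((u * (coincidences x - meanCoincidences ι k) : ℝ) * Complex.I)‖ ≤
    2 * (ε * (u ^ 2 * (n * (Fintype.card ι : ℝ)⁻¹)) +
        u ^ 4 * (3 * (n * (Fintype.card ι : ℝ)⁻¹) ^ 2 + n * (Fintype.card ι : ℝ)⁻¹) / ε) +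
      u ^ 2 * (Fintype.card ι : ℝ)⁻¹ * θ + (u ^ 2 / 2 * (n * (Fintype.card ι : ℝ)⁻¹)) ^ 2 := by
  have hp0 := card_inv_nonneg (ι := ι)
  have hp1 := card_inv_le_one (ι := ι)
  have hkn : (k : ℝ) ≤ n := by exact_mod_cast hk
  have hk0 : (0 : ℝ) ≤ k := by positivity
  set v : ℝ := k * ((Fintype.card ι : ℝ)⁻¹ * (1 - (Fintype.card ι : ℝ)⁻¹)) with hv
  have hv0 : 0 ≤ v := mul_nonneg hk0 (mul_nonneg hp0 (by linarith))
  have hvn : v ≤ n * (Fintype.card ι : ℝ)⁻¹ := by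
    have : (Fintype.card ι : ℝ)⁻¹ * (1 - (Fintype.card ι : ℝ)⁻¹) ≤ (Fintype.card ι : ℝ)⁻¹ := by
      nlinarith
    rw [hv]; gcongr
  set ρ : ℝ := Real.exp (-(u ^ 2 / 2 * v)) with hρ
  set D : (Fin k → ι) → ι → ℝ := fun y i => (cellCount y i : ℝ) - k * (Fintype.card ι : ℝ)⁻¹ with hD
  set w : (Fin k → ι) → ℝ := fun y => coincidences y - meanCoincidences ι k with hw
  have hρ1 : |ρ - (1 - u ^ 2 / 2 * v)| ≤ (u ^ 2 / 2 * (n * (Fintype.card ι : ℝ)⁻¹)) ^ 2 := by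
    refine (abs_exp_neg_sub_one_add_le (by positivity)).trans ?_
    gcongr
  have hin : ∀ y : Fin k → ι, ‖(𝔼 i, Complex.exp ((u * D y i : ℝ) * Complex.I)) - (ρ : ℂ)‖ ≤
      (𝔼 i, 2 * (ε * (u ^ 2 * D y i ^ 2) + u ^ 4 * D y i ^ 4 / ε)) +
      u ^ 2 * (Fintype.card ι : ℝ)⁻¹ * |w y| +
        (u ^ 2 / 2 * (n * (Fintype.card ι : ℝ)⁻¹)) ^ 2 := by
    intro y
    have e1 : (𝔼 i, (1 + ((u * D y i : ℝ) : ℂ) * Complex.I - ((u * D y i : ℝ) : ℂ) ^ 2 / 2)) =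
        ((1 - u ^ 2 / 2 * (v + 2 * (Fintype.card ι : ℝ)⁻¹ * w y) : ℝ) : ℂ) := by
      have q1 : (𝔼 i, D y i) = 0 := expect_sub_mean y
      have q2 : (𝔼 i, D y i ^ 2) = v + 2 * (Fintype.card ι : ℝ)⁻¹ * w y := expect_sub_mean_sq y
      have a1 : ∀ i, (1 + ((u * D y i : ℝ) : ℂ) * Complex.I - ((u * D y i : ℝ) : ℂ) ^ 2 / 2) =
          1 + ((D y i : ℝ) : ℂ) * (u * Complex.I) - ((D y i ^ 2 : ℝ) : ℂ) * (u ^ 2 / 2) := by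
        intro i; push_cast; ring
      simp only [a1, Finset.expect_sub_distrib, Finset.expect_add_distrib, Fintype.expect_const,
        ← Finset.expect_mul, ← Complex.ofReal_expect]
      rw [q1, q2]
      push_cast; ring
    have e2 : (𝔼 i, Complex.exp ((u * D y i : ℝ) * Complex.I)) - (ρ : ℂ) =
        (𝔼 i, (Complex.exp ((u * D y i : ℝ) * Complex.I) -
          (1 + ((u * D y i : ℝ) : ℂ) * Complex.I - ((u * D y i : ℝ) : ℂ) ^ 2 / 2))) +
        ((-(u ^ 2 * (Fintype.card ι : ℝ)⁻¹ * w y) : ℝ) : ℂ) -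
          ((ρ - (1 - u ^ 2 / 2 * v) : ℝ) : ℂ) := by
      rw [Finset.expect_sub_distrib, e1]; push_cast; ring
    rw [e2]
    refine (norm_sub_le _ _).trans (add_le_add ((norm_add_le _ _).trans (add_le_add ?_ ?_)) ?_)
    · refine (RCLike.norm_expect_le (K := ℂ)).trans (Finset.expect_le_expect fun i _ => ?_)
      refine (norm_cexp_ofReal_mul_I_sub_taylor_le _).trans ?_
      have := pow_three_abs_le (u * D y i) hε
      calc 4 * |u * D y i| ^ 3 ≤ 4 * ((ε * (u * D y i) ^ 2 + (u * D y i) ^ 4 / ε) / 2) := by gcongr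
        _ = _ := by ring
    · rw [Complex.norm_real, Real.norm_eq_abs, abs_neg, abs_mul, abs_of_nonneg (by positivity)]
    · rw [Complex.norm_real, Real.norm_eq_abs]
      exact hρ1
  have e3 : (𝔼 x : Fin (k + 1) → ι, Complex.exp
        ((u * (coincidences x - meanCoincidences ι (k + 1)) : ℝ) * Complex.I)) =
      𝔼 y : Fin k → ι, Complex.exp ((u * w y : ℝ) * Complex.I) *
        𝔼 i, Complex.exp ((u * D y i : ℝ) * Complex.I) := by
    rw [expect_fin_cons]
    refine Finset.expect_congr rfl fun y _ => ?_
    rw [Finset.mul_expect]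
    refine Finset.expect_congr rfl fun i _ => ?_
    rw [coincidences_cons, meanCoincidences_succ, ← Complex.exp_add, hw, hD]
    push_cast
    ring_nf
  rw [e3, Finset.mul_expect, ← Finset.expect_sub_distrib]
  refine (RCLike.norm_expect_le (K := ℂ)).trans ?_
  have h4 : ∀ y : Fin k → ι, ‖Complex.exp ((u * w y : ℝ) * Complex.I) *
        (𝔼 i, Complex.exp ((u * D y i : ℝ) * Complex.I)) -
          (ρ : ℂ) * Complex.exp ((u * w y : ℝ) * Complex.I)‖ ≤
      (𝔼 i, 2 * (ε * (u ^ 2 * D y i ^ 2) + u ^ 4 * D y i ^ 4 / ε)) +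
      u ^ 2 * (Fintype.card ι : ℝ)⁻¹ * |w y| +
        (u ^ 2 / 2 * (n * (Fintype.card ι : ℝ)⁻¹)) ^ 2 := by
    intro y
    rw [mul_comm (ρ : ℂ), ← mul_sub, norm_mul, Complex.norm_exp_ofReal_mul_I, one_mul]
    exact hin y
  refine (Finset.expect_le_expect fun y _ => h4 y).trans ?_
  rw [Finset.expect_add_distrib, Finset.expect_add_distrib, Fintype.expect_const,
    ← Finset.mul_expect]
  have h5 := expect_abs_coincidences_sub_le hk hθ h
  have h6 : (𝔼 y : Fin k → ι, 𝔼 i, 2 * (ε * (u ^ 2 * D y i ^ 2) + u ^ 4 * D y i ^ 4 / ε)) ≤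
      2 * (ε * (u ^ 2 * (n * (Fintype.card ι : ℝ)⁻¹)) +
        u ^ 4 * (3 * (n * (Fintype.card ι : ℝ)⁻¹) ^ 2 + n * (Fintype.card ι : ℝ)⁻¹) / ε) := by
    -- With the averages exchanged, the cell i is fixed and D is a centred binomial count, whose
    -- moments are known.
    rw [Finset.expect_comm]
    refine Finset.expect_le (Finset.univ_nonempty) fun i _ => ?_
    have m2 := expect_cellCount_sub_sq k i
    have m4 := expect_cellCount_sub_pow_four_le k i
    have m4' : (𝔼 y : Fin k → ι, D y i ^ 4) ≤
        3 * (n * (Fintype.card ι : ℝ)⁻¹) ^ 2 + n * (Fintype.card ι : ℝ)⁻¹ :=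
      m4.trans (by gcongr)
    have m2' : (𝔼 y : Fin k → ι, D y i ^ 2) ≤ n * (Fintype.card ι : ℝ)⁻¹ := m2.le.trans hvn
    simp only [← Finset.mul_expect, Finset.expect_add_distrib, ← Finset.expect_div]
    have hu4 : 0 ≤ u ^ 4 := by positivity
    gcongr
  gcongr

/-- Gaussian approximation of the centred number of coincidences in a uniform sample. -/
theorem norm_expect_cexp_coincidences_sub_gaussian_le (u : ℝ) (n : ℕ) {θ ε : ℝ}
    (hθ : 0 < θ) (hε : 0 < ε) (h : (n : ℝ) ^ 2 / 2 * (Fintype.card ι : ℝ)⁻¹ ≤ θ ^ 2) :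
    ‖(𝔼 x : Fin n → ι, Complex.exp
        ((u * (coincidences x - meanCoincidences ι n) : ℝ) * Complex.I)) -
      (Real.exp (-(u ^ 2 / 2 * (meanCoincidences ι n * (1 - (Fintype.card ι : ℝ)⁻¹)))) : ℂ)‖ ≤
    n * (2 * (ε * (u ^ 2 * (n * (Fintype.card ι : ℝ)⁻¹)) +
        u ^ 4 * (3 * (n * (Fintype.card ι : ℝ)⁻¹) ^ 2 + n * (Fintype.card ι : ℝ)⁻¹) / ε) +
      u ^ 2 * (Fintype.card ι : ℝ)⁻¹ * θ +
        (u ^ 2 / 2 * (n * (Fintype.card ι : ℝ)⁻¹)) ^ 2) := by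
  have hp0 := card_inv_nonneg (ι := ι)
  have hp1 := card_inv_le_one (ι := ι)
  have key := norm_sub_prod_le
    (fun k => 𝔼 x : Fin k → ι, Complex.exp
      ((u * (coincidences x - meanCoincidences ι k) : ℝ) * Complex.I))
    (fun k => (Real.exp (-(u ^ 2 / 2 *
        (k * ((Fintype.card ι : ℝ)⁻¹ * (1 - (Fintype.card ι : ℝ)⁻¹))))) : ℂ))
    _ (by simp [coincidences_zero, meanCoincidences]) n
    (fun k _ => by
      rw [Complex.norm_real, Real.norm_eq_abs, Real.abs_exp, Real.exp_le_one_iff, neg_nonpos]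
      have : 0 ≤ 1 - (Fintype.card ι : ℝ)⁻¹ := by linarith
      positivity)
    (fun k hk => norm_expect_cexp_sub_gaussian_step_le u hk.le hθ hε h)
  rw [← Complex.ofReal_prod, ← Real.exp_sum, Finset.sum_neg_distrib, ← Finset.mul_sum] at key
  have e : ∑ k ∈ Finset.range n, (k : ℝ) *
      ((Fintype.card ι : ℝ)⁻¹ * (1 - (Fintype.card ι : ℝ)⁻¹)) =
      meanCoincidences ι n * (1 - (Fintype.card ι : ℝ)⁻¹) := by
    simp only [← mul_assoc]
    rw [← Finset.sum_mul, sum_range_mul_card_inv]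
  rw [e] at key
  exact key

end CharacteristicFunctionBounds

/-! ### From random variables to finite averages. -/

section Transfer

/-- For uniform p only Σ c² = 2C + n and Σ c = n enter. -/
lemma standardizedChiSq_eq {n m : ℕ} (hn : n ≠ 0) (hm : m ≠ 0) {p : Fin m → ℝ}
    (hp : ∀ i, p i = (m : ℝ)⁻¹) (x : Fin n → Fin m) :
    standardizedChiSq p x = √(2 * m) / n * coincidences x - n / √(2 * m) := by
  have hn' : (n : ℝ) ≠ 0 := by exact_mod_cast hn
  have hm' : (m : ℝ) ≠ 0 := by exact_mod_cast hm
  have hm0 : (0 : ℝ) < 2 * m := by positivity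
  have hs : √(2 * (m : ℝ)) ≠ 0 := (Real.sqrt_pos.2 hm0).ne'
  have hs2 : √(2 * (m : ℝ)) ^ 2 = 2 * m := Real.sq_sqrt hm0.le
  have hc : ∀ i, empiricalFreq x i = (n : ℝ)⁻¹ * cellCount x i := by
    intro i; simp [empiricalFreq, cellCount]
  have h1 : (∑ i, (cellCount x i : ℝ)) = n := by exact_mod_cast sum_cellCount x
  have hP : pearsonChiSq p x = m + 2 * m / n * coincidences x - n := by
    have e : ∀ i, (empiricalFreq x i - p i) ^ 2 / p i =
        m / (n : ℝ) ^ 2 * (cellCount x i : ℝ) ^ 2 - 2 / n * cellCount x i + (m : ℝ)⁻¹ := by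
      intro i
      rw [hc, hp]
      field_simp
      ring
    rw [pearsonChiSq]
    simp only [e, Finset.sum_add_distrib, Finset.sum_sub_distrib, ← Finset.mul_sum,
      sum_cellCount_sq, h1, Finset.sum_const, Finset.card_univ, Fintype.card_fin, nsmul_eq_mul]
    field_simp
    ring
  rw [standardizedChiSq, hP]
  generalize √(2 * (m : ℝ)) = s at hs hs2 ⊢
  field_simp
  rw [hs2]
  ring

lemma integral_comp_eq_expect {n m : ℕ} {Ω : Type*} [MeasurableSpace Ω] {μ : Measure Ω}
    [IsProbabilityMeasure μ] {X : Fin n → Ω → Fin m} (hX : ∀ k, Measurable (X k))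
    (hindep : iIndepFun X μ) (hlaw : ∀ k i, μ.real {ω | X k ω = i} = (m : ℝ)⁻¹)
    (g : (Fin n → Fin m) → ℂ) :
    ∫ ω, g (fun k => X k ω) ∂μ = 𝔼 x, g x := by
  have hXm : Measurable fun ω k => X k ω := measurable_pi_lambda _ hX
  rw [← integral_map (φ := fun ω k => X k ω) hXm.aemeasurable (f := g)
    (Measurable.of_discrete.aestronglyMeasurable)]
  have : IsProbabilityMeasure (μ.map fun ω k => X k ω) :=
    Measure.isProbabilityMeasure_map hXm.aemeasurable
  rw [integral_fintype (Integrable.of_finite), Fintype.expect_eq_sum_div_card, Finset.sum_div]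
  refine Finset.sum_congr rfl fun x _ => ?_
  have hx : (μ.map fun ω k => X k ω).real {x} = ((m : ℝ)⁻¹) ^ n := by
    rw [map_measureReal_apply hXm (measurableSet_singleton x)]
    have e : (fun ω k => X k ω) ⁻¹' {x} =
        ⋂ k ∈ (Finset.univ : Finset (Fin n)), X k ⁻¹' {x k} := by
      ext ω; simp [funext_iff]
    rw [e, measureReal_def, hindep.measure_inter_preimage_eq_mul _
      (fun k _ => measurableSet_singleton _), ENNReal.toReal_prod]
    have : ∀ k, (μ (X k ⁻¹' {x k})).toReal = (m : ℝ)⁻¹ := fun k => hlaw k (x k)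
    simp [this]
  rw [hx]
  simp [div_eq_inv_mul]

lemma charFun_map_eq_expect {n m : ℕ} {Ω : Type*} [MeasurableSpace Ω] {μ : Measure Ω}
    [IsProbabilityMeasure μ] {X : Fin n → Ω → Fin m} (hX : ∀ k, Measurable (X k))
    (hindep : iIndepFun X μ) (hlaw : ∀ k i, μ.real {ω | X k ω = i} = (m : ℝ)⁻¹)
    (S : (Fin n → Fin m) → ℝ) (t : ℝ) :
    charFun (μ.map fun ω => S fun k => X k ω) t = 𝔼 x, Complex.exp ((t * S x : ℝ) * Complex.I) := by
  have hXm : Measurable fun ω k => X k ω := measurable_pi_lambda _ hX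
  have hS : Measurable fun ω => S fun k => X k ω := Measurable.of_discrete.comp hXm
  rw [charFun_apply_real, integral_map hS.aemeasurable (by fun_prop),
    ← integral_comp_eq_expect hX hindep hlaw]
  push_cast
  rfl

lemma tendstoInDistribution_of_tendsto_charFun {Ω : ℕ → Type*} [∀ n, MeasurableSpace (Ω n)]
    {μ : (n : ℕ) → Measure (Ω n)} [∀ n, IsProbabilityMeasure (μ n)]
    {Ω' : Type*} [MeasurableSpace Ω'] {ν : Measure Ω'} [IsProbabilityMeasure ν]
    {S : (n : ℕ) → Ω n → ℝ} {Z : Ω' → ℝ} (hS : ∀ n, AEMeasurable (S n) (μ n))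
    (hZ : AEMeasurable Z ν)
    (h : ∀ t, Tendsto (fun n => charFun ((μ n).map (S n)) t) atTop (𝓝 (charFun (ν.map Z) t))) :
    TendstoInDistribution S atTop Z μ ν where
  forall_aemeasurable := hS
  aemeasurable_limit := hZ
  tendsto := ProbabilityMeasure.tendsto_of_tendsto_charFun h

end Transfer

/-! ### Asymptotics in the sparse and dense regimes. -/

section Limits

variable {m : ℕ → ℕ}

lemma tendsto_inv_sqrt_natCast (hm : Tendsto m atTop atTop) :
    Tendsto (fun n => (√(m n : ℝ))⁻¹) atTop (𝓝 0) :=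
  tendsto_inv_atTop_zero.comp
    (Real.tendsto_sqrt_atTop.comp (tendsto_natCast_atTop_atTop.comp hm))

lemma meanCoincidences_fin_eq {n m : ℕ} (hm : m ≠ 0) : meanCoincidences (Fin m) n =
    ((n : ℝ) / √(m : ℝ)) ^ 2 / 2 - ((n : ℝ) / √(m : ℝ)) * (√(m : ℝ))⁻¹ / 2 := by
  have hm' : (0 : ℝ) < m := by positivity
  have hs : √(m : ℝ) ≠ 0 := (Real.sqrt_pos.2 hm').ne'
  have hs2 : √(m : ℝ) ^ 2 = m := Real.sq_sqrt hm'.le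
  rw [meanCoincidences, Fintype.card_fin]
  generalize √(m : ℝ) = s at hs hs2 ⊢
  rw [← hs2]
  field_simp

lemma eventually_ne_zero (hm : Tendsto m atTop atTop) : ∀ᶠ n in atTop, n ≠ 0 ∧ m n ≠ 0 := by
  filter_upwards [eventually_ge_atTop 1, hm.eventually_ge_atTop 1] with n h1 h2
  omega

/-- In the sparse regime the characteristic function of the standardised statistic is
asymptotically that of an affine function of a Poisson variable. -/
lemma tendsto_expect_standardizedChiSq_sub_poisson (hm : Tendsto m atTop atTop)
    {p : (n : ℕ) → Fin (m n) → ℝ} (hp : ∀ n i, p n i = (m n : ℝ)⁻¹) {l : ℝ}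
    (hl : Tendsto (fun n : ℕ => (n : ℝ) / √(m n : ℝ)) atTop (𝓝 l)) (t : ℝ) :
    Tendsto (fun n : ℕ => (𝔼 x : Fin n → Fin (m n),
        Complex.exp ((t * standardizedChiSq (p n) x : ℝ) * Complex.I)) -
      Complex.exp ((-(t * (n / √(2 * m n))) : ℝ) * Complex.I) *
        Complex.exp (meanCoincidences (Fin (m n)) n *
          (Complex.exp ((t * (√(2 * m n) / n) : ℝ) * Complex.I) - 1))) atTop (𝓝 0) := by
  have hs := tendsto_inv_sqrt_natCast hm
  -- This is 7n³/m², rewritten through the convergent ratio n/√m.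
  have hb : Tendsto (fun n : ℕ => 7 * ((n : ℝ) / √(m n : ℝ)) ^ 3 * (√(m n : ℝ))⁻¹) atTop (𝓝 0) := by
    simpa using ((hl.pow 3).const_mul 7).mul hs
  have hsmall : Tendsto (fun n : ℕ => 2 * ((n : ℝ) / √(m n : ℝ)) * (√(m n : ℝ))⁻¹) atTop (𝓝 0) := by
    simpa using (hl.const_mul 2).mul hs
  refine squeeze_zero_norm' ?_ hb
  filter_upwards [eventually_ne_zero hm, hsmall.eventually_le_const one_pos] with n ⟨hn, hmn⟩ h1
  have : Nonempty (Fin (m n)) := ⟨⟨0, Nat.pos_of_ne_zero hmn⟩⟩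
  have hm' : (0 : ℝ) < m n := by positivity
  have hs0 : √(m n : ℝ) ≠ 0 := (Real.sqrt_pos.2 hm').ne'
  have hs2 : (m n : ℝ) = √(m n : ℝ) ^ 2 := (Real.sq_sqrt hm'.le).symm
  have e : (𝔼 x : Fin n → Fin (m n),
        Complex.exp ((t * standardizedChiSq (p n) x : ℝ) * Complex.I)) =
      Complex.exp ((-(t * (n / √(2 * m n))) : ℝ) * Complex.I) *
      𝔼 x : Fin n → Fin (m n),
        Complex.exp (((t * (√(2 * m n) / n)) * coincidences x : ℝ) * Complex.I) := by
    rw [Finset.mul_expect]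
    refine Finset.expect_congr rfl fun x _ => ?_
    rw [standardizedChiSq_eq hn hmn (hp n), ← Complex.exp_add]
    push_cast
    ring_nf
  rw [e, ← mul_sub, norm_mul, Complex.norm_exp_ofReal_mul_I, one_mul]
  refine (norm_expect_cexp_coincidences_sub_poisson_le _ n ?_).trans (le_of_eq ?_)
  · rw [Fintype.card_fin]
    refine le_trans (le_of_eq ?_) h1
    conv_lhs => rw [hs2]
    field_simp
  · rw [Fintype.card_fin]
    conv_lhs => rw [hs2]
    field_simp

/-- In the dense regime the characteristic function of the standardised statistic is
asymptotically Gaussian. -/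
lemma tendsto_expect_standardizedChiSq_gaussian (hm : Tendsto m atTop atTop)
    {p : (n : ℕ) → Fin (m n) → ℝ} (hp : ∀ n i, p n i = (m n : ℝ)⁻¹)
    (hl : Tendsto (fun n : ℕ => (n : ℝ) / √(m n : ℝ)) atTop atTop) (t : ℝ) :
    Tendsto (fun n : ℕ => (𝔼 x : Fin n → Fin (m n),
        Complex.exp ((t * standardizedChiSq (p n) x : ℝ) * Complex.I)))
      atTop (𝓝 (Real.exp (-(t ^ 2 / 2)) : ℂ)) := by
  have hs := tendsto_inv_sqrt_natCast hm
  have hr := tendsto_inv_atTop_zero.comp hl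
  have hn := tendsto_inv_atTop_nhds_zero_nat (𝕜 := ℝ)
  have hp' : Tendsto (fun n => (m n : ℝ)⁻¹) atTop (𝓝 0) :=
    tendsto_inv_atTop_zero.comp (tendsto_natCast_atTop_atTop.comp hm)
  have hb : Tendsto (fun n : ℕ => 2 * (2 * t ^ 2 + t ^ 4) *
      √(12 * (n : ℝ)⁻¹ + 4 * ((n : ℝ) / √(m n : ℝ))⁻¹ ^ 2) +
      2 * t ^ 2 / √2 * (√(m n : ℝ))⁻¹ + t ^ 4 * (n : ℝ)⁻¹) atTop (𝓝 0) := by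
    have h0 : Tendsto (fun n : ℕ => √(12 * (n : ℝ)⁻¹ + 4 * ((n : ℝ) / √(m n : ℝ))⁻¹ ^ 2))
        atTop (𝓝 0) := by
      simpa using ((hn.const_mul 12).add ((hr.pow 2).const_mul 4)).sqrt
    simpa using ((h0.const_mul (2 * (2 * t ^ 2 + t ^ 4))).add
      (hs.const_mul (2 * t ^ 2 / √2))).add (hn.const_mul (t ^ 4))
  -- The phase remains because C has mean n(n-1)/(2m), while the statistic subtracts the equivalent
  -- of n²/(2m).
  have hG : Tendsto (fun n : ℕ => Complex.exp ((-(t / √2 * (√(m n : ℝ))⁻¹) : ℝ) * Complex.I) *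
      (Real.exp (-(t ^ 2 / 2 * ((1 - (n : ℝ)⁻¹) * (1 - (m n : ℝ)⁻¹)))) : ℂ)) atTop
      (𝓝 (Real.exp (-(t ^ 2 / 2)) : ℂ)) := by
    have a1 : Tendsto (fun n : ℕ => ((-(t / √2 * (√(m n : ℝ))⁻¹) : ℝ) : ℂ)) atTop (𝓝 ((0 : ℝ) : ℂ)) :=
      (Complex.continuous_ofReal.tendsto _).comp (by simpa using (hs.const_mul (t / √2)).neg)
    have a2 : Tendsto (fun n : ℕ => Real.exp (-(t ^ 2 / 2 * ((1 - (n : ℝ)⁻¹) * (1 - (m n : ℝ)⁻¹)))))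
        atTop (𝓝 (Real.exp (-(t ^ 2 / 2)))) := by
      refine (Real.continuous_exp.tendsto _).comp ?_
      simpa using (((hn.const_sub 1).mul (hp'.const_sub 1)).const_mul (t ^ 2 / 2)).neg
    have a3 := (Complex.continuous_exp.tendsto _).comp (a1.mul_const Complex.I)
    simpa using a3.mul ((Complex.continuous_ofReal.tendsto _).comp a2)
  refine hG.congr_dist (squeeze_zero_norm' ?_ hb)
  filter_upwards [eventually_ne_zero hm] with n ⟨hn, hmn⟩
  have : Nonempty (Fin (m n)) := ⟨⟨0, Nat.pos_of_ne_zero hmn⟩⟩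
  have hn' : (0 : ℝ) < n := by positivity
  have hm' : (0 : ℝ) < m n := by positivity
  have hs0 : 0 < √(m n : ℝ) := Real.sqrt_pos.2 hm'
  have hs2 : √(m n : ℝ) ^ 2 = (m n : ℝ) := Real.sq_sqrt hm'.le
  have h20 : 0 < √(2 : ℝ) := by positivity
  have h22 : √(2 : ℝ) ^ 2 = 2 := Real.sq_sqrt (by norm_num)
  have hsm : √(2 * (m n : ℝ)) = √2 * √(m n : ℝ) := Real.sqrt_mul (by norm_num) _
  -- The accumulated fourth-moment error is t⁴q/ε and the second-moment one 2t²ε, so ε = √q makes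
  -- both of order √q.
  set q : ℝ := 12 * (n : ℝ)⁻¹ + 4 * ((n : ℝ) / √(m n : ℝ))⁻¹ ^ 2 with hq
  have hq0 : 0 < q := by positivity
  set u : ℝ := t * (√(2 * m n) / n) with hu
  have hu2 : u ^ 2 = 2 * t ^ 2 * m n / n ^ 2 := by
    rw [hu, mul_pow, div_pow, Real.sq_sqrt (by positivity)]; ring
  have hu4 : u ^ 4 = (2 * t ^ 2 * m n / n ^ 2) ^ 2 := by rw [← hu2]; ring
  have e : (𝔼 x : Fin n → Fin (m n),
        Complex.exp ((t * standardizedChiSq (p n) x : ℝ) * Complex.I)) =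
      Complex.exp ((-(t / √2 * (√(m n : ℝ))⁻¹) : ℝ) * Complex.I) *
      𝔼 x : Fin n → Fin (m n), Complex.exp
        ((u * (coincidences x - meanCoincidences (Fin (m n)) n) : ℝ) * Complex.I) := by
    rw [Finset.mul_expect]
    refine Finset.expect_congr rfl fun x _ => ?_
    rw [standardizedChiSq_eq hn hmn (hp n), ← Complex.exp_add, ← add_mul, ← Complex.ofReal_add]
    congr 3
    rw [hu, meanCoincidences, Fintype.card_fin, hsm]
    clear_value u q
    clear hq hu2 hu4 hq0 hu
    generalize √(m n : ℝ) = s at hs0 hs2 ⊢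
    generalize √(2 : ℝ) = r at h20 h22 ⊢
    rw [← hs2]
    field_simp
    ring_nf
    rw [h22]
    ring
  have e2 : t ^ 2 / 2 * ((1 - (n : ℝ)⁻¹) * (1 - (m n : ℝ)⁻¹)) =
      u ^ 2 / 2 * (meanCoincidences (Fin (m n)) n * (1 - (Fintype.card (Fin (m n)) : ℝ)⁻¹)) := by
    rw [hu2, meanCoincidences, Fintype.card_fin]
    field_simp
  -- The smallest admissible θ: its square is exactly n²/(2m).
  have hθ : (0 : ℝ) < n / √(2 * m n) := by positivity
  have key := norm_expect_cexp_coincidences_sub_gaussian_le (ι := Fin (m n)) u n hθ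
    (Real.sqrt_pos.2 hq0) (by
      rw [div_pow, Real.sq_sqrt (by positivity), Fintype.card_fin]
      exact le_of_eq (by field_simp))
  rw [Real.norm_eq_abs, abs_of_nonneg dist_nonneg, dist_comm, dist_eq_norm, e, e2, ← mul_sub,
    norm_mul, Complex.norm_exp_ofReal_mul_I, one_mul]
  refine key.trans (le_of_eq ?_)
  have hqq : √q ^ 2 = q := Real.sq_sqrt hq0.le
  have hqpos : 0 < √q := Real.sqrt_pos.2 hq0
  have t1 : n * (√q * (u ^ 2 * (n * (m n : ℝ)⁻¹))) = 2 * t ^ 2 * √q := by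
    rw [hu2]; field_simp
  have t2 : n * (u ^ 4 * (3 * (n * (m n : ℝ)⁻¹) ^ 2 + n * (m n : ℝ)⁻¹)) = t ^ 4 * √q ^ 2 := by
    rw [hqq, hu4, hq, inv_div, div_pow √(m n : ℝ), hs2]; field_simp; ring
  have t3 : n * (u ^ 2 * (m n : ℝ)⁻¹ * (n / √(2 * m n))) = 2 * t ^ 2 / √2 * (√(m n : ℝ))⁻¹ := by
    rw [hu2, hsm]; field_simp
  have t4 : n * (u ^ 2 / 2 * (n * (m n : ℝ)⁻¹)) ^ 2 = t ^ 4 * (n : ℝ)⁻¹ := by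
    rw [hu2]; field_simp
  have t2' : n * (u ^ 4 * (3 * (n * (m n : ℝ)⁻¹) ^ 2 + n * (m n : ℝ)⁻¹) / √q) = t ^ 4 * √q := by
    rw [← mul_div_assoc, t2]; field_simp
  rw [Fintype.card_fin]
  linear_combination 2 * t1 + 2 * t2' + t3 + t4

end Limits

theorem corollary3p2
    -- the numbers of categories
    (m : ℕ → ℕ) (hm : Tendsto m atTop atTop)
    -- the category probabilities, uniform for each `n`
    (p : (n : ℕ) → Fin (m n) → ℝ) (hp : ∀ n i, p n i = (m n : ℝ)⁻¹)
    -- the `n`-th row is an iid sample of size `n` with `P(X = i) = p n i`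
    {Ω : ℕ → Type*} [∀ n, MeasurableSpace (Ω n)]
    (μ : (n : ℕ) → Measure (Ω n)) [∀ n, IsProbabilityMeasure (μ n)]
    (X : (n : ℕ) → Fin n → Ω n → Fin (m n))
    (hX : ∀ n k, Measurable (X n k))
    (hindep : ∀ n, iIndepFun (X n) (μ n))
    (hlaw : ∀ n k i, (μ n).real {ω | X n k ω = i} = p n i)
    -- the probability space carrying the limit variable
    {Ω' : Type*} [MeasurableSpace Ω'] (ν : Measure Ω') [IsProbabilityMeasure ν] :
    (Tendsto (fun n : ℕ => (n : ℝ) / √(m n : ℝ)) atTop (𝓝 0) →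
      TendstoInDistribution (fun n ω => standardizedChiSq (p n) (fun k => X n k ω)) atTop
        (fun _ : Ω' => (0 : ℝ)) μ ν) ∧
    (∀ l : ℝ, 0 < l →
      Tendsto (fun n : ℕ => (n : ℝ) / √(m n : ℝ)) atTop (𝓝 l) →
      ∀ Z : Ω' → ℕ, HasLaw Z (poissonMeasure (l ^ 2 / 2).toNNReal) ν →
        TendstoInDistribution (fun n ω => standardizedChiSq (p n) (fun k => X n k ω)) atTop
          (fun ω => √2 / l * (Z ω : ℝ) - l / √2) μ ν) ∧
    (Tendsto (fun n : ℕ => (n : ℝ) / √(m n : ℝ)) atTop atTop →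
      ∀ N : Ω' → ℝ, HasLaw N (gaussianReal 0 1) ν →
        TendstoInDistribution (fun n ω => standardizedChiSq (p n) (fun k => X n k ω)) atTop
          N μ ν) := by
  have hS : ∀ n, AEMeasurable (fun ω => standardizedChiSq (p n) (fun k => X n k ω)) (μ n) :=
    fun n => ((Measurable.of_discrete (f := standardizedChiSq (p n))).comp
      (measurable_pi_lambda _ (hX n))).aemeasurable
  have hchar : ∀ (t : ℝ) (n : ℕ),
      charFun ((μ n).map fun ω => standardizedChiSq (p n) (fun k => X n k ω)) t =
        𝔼 x : Fin n → Fin (m n),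
          Complex.exp ((t * standardizedChiSq (p n) x : ℝ) * Complex.I) := fun t n =>
    charFun_map_eq_expect (hX n) (hindep n) (fun k i => (hlaw n k i).trans (hp n i)) _ t
  have hs := tendsto_inv_sqrt_natCast hm
  have hmean : ∀ l : ℝ, Tendsto (fun n : ℕ => (n : ℝ) / √(m n : ℝ)) atTop (𝓝 l) →
      Tendsto (fun n => meanCoincidences (Fin (m n)) n) atTop (𝓝 (l ^ 2 / 2)) := by
    intro l hl
    have h := ((hl.pow 2).div_const 2).sub ((hl.mul hs).div_const 2)
    rw [mul_zero, zero_div, sub_zero] at h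
    refine h.congr' ?_
    filter_upwards [eventually_ne_zero hm] with n hn
    exact (meanCoincidences_fin_eq hn.2).symm
  have hshift : ∀ l : ℝ, Tendsto (fun n : ℕ => (n : ℝ) / √(m n : ℝ)) atTop (𝓝 l) → ∀ t : ℝ,
      Tendsto (fun n : ℕ => Complex.exp ((-(t * (n / √(2 * m n))) : ℝ) * Complex.I)) atTop
        (𝓝 (Complex.exp ((-(t * (l / √2)) : ℝ) * Complex.I))) := by
    intro l hl t
    have h : Tendsto (fun n : ℕ => -(t * (n / √(2 * m n)))) atTop (𝓝 (-(t * (l / √2)))) := by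
      refine (((hl.div_const √2).const_mul t).neg).congr fun n => ?_
      rw [Real.sqrt_mul (by norm_num), div_div, mul_comm √(m n : ℝ)]
    exact (Complex.continuous_exp.tendsto _).comp
      (((Complex.continuous_ofReal.tendsto _).comp h).mul_const Complex.I)
  refine ⟨fun hl => ?_, fun l hl0 hl Z hZ => ?_, fun hl N hN => ?_⟩
  · refine tendstoInDistribution_of_tendsto_charFun hS aemeasurable_const fun t => ?_
    simp only [hchar]
    have h1 := tendsto_expect_standardizedChiSq_sub_poisson hm hp hl t
    -- The angle t√(2m)/n need not converge when n/√m → 0. The bound 2 on the second factor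
    -- suffices, since the mean tends to 0.
    have h2 : Tendsto (fun n : ℕ => (meanCoincidences (Fin (m n)) n : ℂ) *
        (Complex.exp ((t * (√(2 * m n) / n) : ℝ) * Complex.I) - 1)) atTop (𝓝 0) := by
      have hb := (hmean 0 hl).norm.mul_const 2
      norm_num at hb
      refine squeeze_zero_norm (fun n => ?_) hb
      rw [norm_mul, Complex.norm_real, Real.norm_eq_abs]
      gcongr
      refine (norm_sub_le _ _).trans ?_
      rw [Complex.norm_exp_ofReal_mul_I]
      norm_num
    have h3 := h1.add ((hshift 0 hl t).mul ((Complex.continuous_exp.tendsto _).comp h2))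
    have e : charFun (ν.map fun _ : Ω' => (0 : ℝ)) t = 1 := by
      simp [Measure.map_const, charFun_dirac]
    rw [e]
    simpa using h3
  · have hZm : AEMeasurable Z ν := hZ.aemeasurable
    have hZr : AEMeasurable (fun ω => (Z ω : ℝ)) ν :=
      (Measurable.of_discrete (f := fun k : ℕ => (k : ℝ))).comp_aemeasurable hZm
    refine tendstoInDistribution_of_tendsto_charFun hS ((hZr.const_mul _).sub_const _) fun t => ?_
    simp only [hchar]
    have h1 := tendsto_expect_standardizedChiSq_sub_poisson hm hp hl t
    have hu : Tendsto (fun n : ℕ => t * (√(2 * m n) / n)) atTop (𝓝 (t * (√2 / l))) := by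
      refine (((hl.inv₀ hl0.ne').const_mul √2).const_mul t).congr fun n => ?_
      rw [Real.sqrt_mul (by norm_num), inv_div, mul_div_assoc]
    have h2 : Tendsto (fun n : ℕ => (meanCoincidences (Fin (m n)) n : ℂ) *
        (Complex.exp ((t * (√(2 * m n) / n) : ℝ) * Complex.I) - 1)) atTop
        (𝓝 (((l ^ 2 / 2 : ℝ) : ℂ) * (Complex.exp ((t * (√2 / l) : ℝ) * Complex.I) - 1))) :=
      ((Complex.continuous_ofReal.tendsto _).comp (hmean l hl)).mul
        (((Complex.continuous_exp.tendsto _).comp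
          (((Complex.continuous_ofReal.tendsto _).comp hu).mul_const Complex.I)).sub_const 1)
    have h3 := h1.add ((hshift l hl t).mul ((Complex.continuous_exp.tendsto _).comp h2))
    have e : charFun (ν.map fun ω => √2 / l * (Z ω : ℝ) - l / √2) t =
        Complex.exp ((-(t * (l / √2)) : ℝ) * Complex.I) * Complex.exp
          (((l ^ 2 / 2 : ℝ) : ℂ) * (Complex.exp ((t * (√2 / l) : ℝ) * Complex.I) - 1)) := by
      -- Evaluating the Poisson characteristic function at t√2/l absorbs the scaling of Z; the shift
      -- supplies the phase.
      have hpois := charFun_map_cast_poissonMeasure (l ^ 2 / 2).toNNReal (t * (√2 / l))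
      rw [← hZ.map_eq, AEMeasurable.map_map_of_aemeasurable
        (Measurable.of_discrete.aemeasurable) hZm, charFun_apply_real,
        integral_map (Measurable.of_discrete.comp_aemeasurable hZm) (by fun_prop)] at hpois
      rw [charFun_apply_real, integral_map ((hZr.const_mul _).sub_const _) (by fun_prop)]
      have hc : (((l ^ 2 / 2).toNNReal : ℝ) : ℂ) = ((l ^ 2 / 2 : ℝ) : ℂ) := by
        rw [Real.coe_toNNReal _ (by positivity)]
      rw [hc] at hpois
      rw [← hpois, ← integral_const_mul]
      refine integral_congr_ae (Eventually.of_forall fun ω => ?_)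
      simp only [Function.comp]
      rw [← Complex.exp_add]
      push_cast
      ring_nf
    rw [e]
    simpa using h3
  · refine tendstoInDistribution_of_tendsto_charFun hS hN.aemeasurable fun t => ?_
    simp only [hchar]
    have e : charFun (ν.map N) t = (Real.exp (-(t ^ 2 / 2)) : ℂ) := by
      rw [hN.map_eq, charFun_gaussianReal]
      push_cast
      congr 1
      simp
    rw [e]
    exact tendsto_expect_standardizedChiSq_gaussian hm hp hl t
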